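/- Let $X=(X_t)_{t\ge 0}$ be a spectrally negative Lévy process under a probability measure $\mathsf P$ with respect to a filtration $\mathcal F=(\mathcal F_t)_{t\ge0}$ (càdlàg, adapted, with stationary increments independent of the past, no positive jumps, non-monotone paths, $X_0=0$ a.s.). Let $\psi(\lambda)=\log \mathsf P[e^{\lambda X_1}]$, $\lambda\ge 0$, be its Laplace exponent and, for $q\ge 0$, let $\Phi(q)$ be the largest $\lambda\ge0$ with $\psi(\lambda)=q$. For $q\geq 0$ let $W^{(q)}:\mathbb R\to[0,\infty)$ be the scale function of $X$, i.e. the unique function that vanishes on $(-\infty,0)$, is continuous on $[0,\infty)$ and satisfies $\int_0^\infty e^{-\lambda x}W^{(q)}(x)\,dx=\frac1{\psi(\lambda)-q}$ for $\lambda>\Phi(q)$. With $\star$ denoting convolution on $\mathbb R$, put, for $q,\theta\ge0$, $$Z^{(q,\theta)}:=e^{\theta\cdot}+(q-\psi(\theta))\,(e^{\theta\cdot}\mathbf 1_{[0,\infty)})\star W^{(q)} .$$ For $\alpha\in\mathbb R$ and $p,q,\theta\ge 0$ let $\mathcal Z^{(q,\theta)}_{\alpha,p}(y):=\mathcal Z(\log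 y)$, $y\in(0,\infty)$, where $\mathcal Z:\mathbb R\to\mathbb R$ is the unique locally bounded Borel measurable function such that $$\mathcal Z=Z^{(p,\theta)}+q\,W^{(p)}\star\big(e^{\alpha\cdot}\mathbf 1_{[0,\infty)}\mathcal Z\big),$$ and write $\mathcal Z^{(q)}_{\alpha,p}:=\mathcal Z^{(q,0)}_{\alpha,p}$. For $\theta\ge0$ let $\mathsf P^\theta$ be the Esscher transform of $\mathsf P$, i.e. a measure with $\frac{d\mathsf P^\theta|_{\mathcal F_t}}{d\mathsf P|_{\mathcal F_t}}=e^{\theta (X_t-X_0)-\psi(\theta)t}$ for all $t\ge0$ (assumed to exist on the given filtered space), and let a left subscript $\theta$ indicate that a quantity is computed for the process $X$ under $\mathsf P^\theta$. Then for all $\alpha\in\mathbb R$, $p,q\in[0,\infty)$ and $\theta\in[0,\Phi(p)]$, $$\mathcal Z^{(q,\theta)}_{\alpha,p}(y)=y^\theta\;{}_\theta\mathcal Z^{(q)}_{\alpha,p-\psi(\theta)}(y),\qquad y\in(0,\infty).$$ -/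

import Mathlib

open MeasureTheory ProbabilityTheory Filter Set
open scoped Topology NNReal ENNReal Convolution

noncomputable section

/-- `X` is a spectrally negative Lévy process in the filtration `ℱ` under `P`, started at `0`:
adapted, càdlàg, with stationary increments that are independent of the past, without positive
jumps, and with non-monotone paths. -/
structure IsSpectrallyNegativeLevy {Ω : Type*} {mΩ : MeasurableSpace Ω}
    (ℱ : Filtration ℝ≥0 mΩ) (X : ℝ≥0 → Ω → ℝ) (P : Measure Ω) : Prop where
  adapted : ∀ t : ℝ≥0, Measurable[ℱ t] (X t)
  start_zero : ∀ᵐ ω ∂P, X 0 ω = 0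
  right_continuous : ∀ᵐ ω ∂P, ∀ t : ℝ≥0, ContinuousWithinAt (fun s => X s ω) (Ici t) t
  left_limits : ∀ᵐ ω ∂P, ∀ t : ℝ≥0, 0 < t →
    ∃ l : ℝ, Tendsto (fun s => X s ω) (𝓝[<] t) (𝓝 l)
  independent_increments : ∀ s h : ℝ≥0,
    Indep (MeasurableSpace.comap (fun ω => X (s + h) ω - X s ω) inferInstance) (ℱ s) P
  stationary_increments : ∀ s h : ℝ≥0,
    IdentDistrib (fun ω => X (s + h) ω - X s ω) (fun ω => X h ω - X 0 ω) P P
  no_positive_jumps : ∀ᵐ ω ∂P, ∀ t : ℝ≥0, 0 < t →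
    ∀ l : ℝ, Tendsto (fun s => X s ω) (𝓝[<] t) (𝓝 l) → X t ω ≤ l
  not_nondecreasing : ¬ ∀ᵐ ω ∂P, Monotone (fun t => X t ω)
  not_nonincreasing : ¬ ∀ᵐ ω ∂P, Antitone (fun t => X t ω)

/-- The Laplace exponent `ψ(λ) = log P[exp(λ X₁)]` of `X` under `P` (of interest for `λ ≥ 0`). -/
def laplaceExponent {Ω : Type*} {mΩ : MeasurableSpace Ω} (X : ℝ≥0 → Ω → ℝ) (P : Measure Ω) :
    ℝ → ℝ :=
  fun l => cgf (X 1) P l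

/-- `Pθ` is the Esscher transform with parameter `θ` of the measure `P`: on every `ℱ t` it has
density `exp(θ (X t - X 0) - ψ(θ) t)` with respect to `P`. -/
def IsEsscherTransform {Ω : Type*} {mΩ : MeasurableSpace Ω} (ℱ : Filtration ℝ≥0 mΩ)
    (X : ℝ≥0 → Ω → ℝ) (P : Measure Ω) (θ : ℝ) (Pθ : Measure Ω) : Prop :=
  ∀ (t : ℝ≥0) (A : Set Ω), MeasurableSet[ℱ t] A →
    Pθ A = ∫⁻ ω in A,
      ENNReal.ofReal (Real.exp (θ * (X t ω - X 0 ω) - laplaceExponent X P θ * (t : ℝ))) ∂P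

/-- `Φ(q)`, the largest `λ ≥ 0` with `ψ(λ) = q`. For the Laplace exponent of a spectrally negative
Lévy process, `Φ(0)` is the largest zero of `ψ`, and `Φ` is the inverse on `[0,∞)` of the
restriction of `ψ` to `[Φ(0),∞)`. -/
def rightInverse (ψ : ℝ → ℝ) (q : ℝ) : ℝ :=
  sSup {l : ℝ | 0 ≤ l ∧ ψ l = q}

/-- `W` is the `q`-scale function of the Laplace exponent `ψ`: nonnegative, zero on `(-∞,0)`,
continuous on `[0,∞)`, with Laplace transform `1 / (ψ - q)` on `(Φ(q),∞)`. -/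
structure IsScaleFunction (ψ : ℝ → ℝ) (q : ℝ) (W : ℝ → ℝ) : Prop where
  nonneg : ∀ x, 0 ≤ W x
  zero_of_neg : ∀ x, x < 0 → W x = 0
  continuousOn : ContinuousOn W (Ici 0)
  laplace : ∀ l, rightInverse ψ q < l →
    ∫⁻ x in Ioi (0 : ℝ), ENNReal.ofReal (Real.exp (-(l * x)) * W x)
      = ENNReal.ofReal (1 / (ψ l - q))

open Classical in
/-- The scale function `W^{(q)}`: the (unique) function satisfying `IsScaleFunction ψ q`. -/
def scaleW (ψ : ℝ → ℝ) (q : ℝ) : ℝ → ℝ :=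
  if h : ∃ W, IsScaleFunction ψ q W then h.choose else 0

/-- The adjoint scale function
`Z^{(q,θ)} = exp(θ ·) + (q - ψ(θ)) (exp(θ ·) 1_{[0,∞)}) ⋆ W^{(q)}`. -/
def scaleZ (ψ : ℝ → ℝ) (q θ : ℝ) : ℝ → ℝ := fun x =>
  Real.exp (θ * x)
    + (q - ψ θ) * (((Ici (0 : ℝ)).indicator fun u => Real.exp (θ * u)) ⋆ scaleW ψ q) x

/-- `f` is a locally bounded Borel measurable solution of the convolution equation
`f = Z^{(p,θ)} + q W^{(p)} ⋆ (exp(α ·) 1_{[0,∞)} f)`. -/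
structure IsZSolution (ψ : ℝ → ℝ) (α p q θ : ℝ) (f : ℝ → ℝ) : Prop where
  measurable : Measurable f
  locally_bounded : ∀ r : ℝ, ∃ C : ℝ, ∀ x, |x| ≤ r → |f x| ≤ C
  equation : ∀ x, f x = scaleZ ψ p θ x
    + q * (scaleW ψ p ⋆ ((Ici (0 : ℝ)).indicator fun u => Real.exp (α * u) * f u)) x

open Classical in
/-- The scale function `𝒵^{(q,θ)}_{α,p}` of the self-similar process associated with a Lévy process
with Laplace exponent `ψ`, the index `α` and the killing rate `p`: at `y > 0` it is `f (log y)`,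
where `f` is the (unique) function satisfying `IsZSolution ψ α p q θ`. -/
def pssmpZ (ψ : ℝ → ℝ) (α p q θ : ℝ) (y : ℝ) : ℝ :=
  (if h : ∃ f, IsZSolution ψ α p q θ f then h.choose else 0) (Real.log y)

end

/-- A finite measure is determined by the moments of a bounded injective random variable. -/
theorem map_eq_of_moments {Ω : Type*} {mΩ : MeasurableSpace Ω} {μ ν : Measure Ω}
    [IsFiniteMeasure μ] [IsFiniteMeasure ν] {T : Ω → ℝ} {a b : ℝ} (hT : Measurable T)
    (hμ : ∀ᵐ x ∂μ, T x ∈ Icc a b) (hν : ∀ᵐ x ∂ν, T x ∈ Icc a b)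
    (h : ∀ n : ℕ, μ[T ^ n] = ν[T ^ n]) : μ.map T = ν.map T := by
  have key : ∀ {ρ : Measure Ω} [IsFiniteMeasure ρ], (∀ᵐ x ∂ρ, T x ∈ Icc a b) →
      integrableExpSet T ρ = univ := by
    intro ρ _ hρ
    refine eq_univ_of_forall fun t => ?_
    exact integrable_exp_mul_of_mem_Icc hT.aemeasurable hρ
  have iμ := key hμ
  have iν := key hν
  have hz : μ = 0 ↔ ν = 0 := by
    have h0 := h 0
    simp only [pow_zero, Pi.one_apply, integral_const, smul_eq_mul, mul_one] at h0
    rw [← Measure.measure_univ_eq_zero, ← Measure.measure_univ_eq_zero]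
    rw [← measureReal_eq_zero_iff, ← measureReal_eq_zero_iff, h0]
  have hmgf : mgf T μ = mgf T ν := by
    have aμ : AnalyticOnNhd ℝ (mgf T μ) univ := by simpa [iμ] using analyticOnNhd_mgf (X := T) (μ := μ)
    have aν : AnalyticOnNhd ℝ (mgf T ν) univ := by simpa [iν] using analyticOnNhd_mgf (X := T) (μ := ν)
    refine aμ.eq_of_eventuallyEq aν (z₀ := 0) ?_
    have pμ := hasFPowerSeriesAt_mgf (X := T) (μ := μ) (v := 0) (by simp [iμ])
    have pν := hasFPowerSeriesAt_mgf (X := T) (μ := ν) (v := 0) (by simp [iν])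
    simp only [zero_mul, Real.exp_zero, mul_one] at pμ pν
    have hh : ∀ n : ℕ, ∫ x, T x ^ n ∂μ = ∫ x, T x ^ n ∂ν := fun n => by simpa using h n
    simp only [hh] at pμ
    filter_upwards [pμ.eventually_hasSum_sub, pν.eventually_hasSum_sub] with z h1 h2
    exact h1.unique h2
  have hc := eqOn_complexMGF_of_mgf' hmgf hz
  refine Measure.ext_of_complexMGF_eq hT.aemeasurable hT.aemeasurable ?_
  ext z
  exact hc (by simp [iμ])

/-- Uniqueness of Laplace transforms, for nonnegative functions that are continuous on `[0,∞)`. -/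
theorem eqOn_of_lintegral_exp_eq {f g : ℝ → ℝ} (hf : ∀ x, 0 ≤ f x) (hg : ∀ x, 0 ≤ g x)
    (hfm : Measurable f) (hgm : Measurable g)
    (hfc : ContinuousOn f (Ici 0)) (hgc : ContinuousOn g (Ici 0)) {L : ℝ}
    (hfin : ∀ l, L < l → ∫⁻ x in Ioi (0 : ℝ), ENNReal.ofReal (Real.exp (-(l * x)) * f x) ≠ ∞)
    (h : ∀ l, L < l → ∫⁻ x in Ioi (0 : ℝ), ENNReal.ofReal (Real.exp (-(l * x)) * f x)
      = ∫⁻ x in Ioi (0 : ℝ), ENNReal.ofReal (Real.exp (-(l * x)) * g x)) :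
    EqOn f g (Ici 0) := by
  set d : (ℝ → ℝ) → ℝ → ℝ≥0∞ := fun f x => ENNReal.ofReal (Real.exp (-((L + 1) * x)) * f x) with hd
  set ρ : (ℝ → ℝ) → Measure ℝ := fun f => (volume.restrict (Ioi (0 : ℝ))).withDensity (d f) with hρ
  have hdm : ∀ {f : ℝ → ℝ}, Measurable f → Measurable (d f) := fun hf => by
    simp only [hd]; fun_prop
  have hL : L < L + 1 := by linarith
  have : IsFiniteMeasure (ρ f) := isFiniteMeasure_withDensity (hfin _ hL)
  have : IsFiniteMeasure (ρ g) := isFiniteMeasure_withDensity (h _ hL ▸ hfin _ hL)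
  have hTm : Measurable fun x : ℝ => Real.exp (-x) := by fun_prop
  have hT01 : ∀ f : ℝ → ℝ, ∀ᵐ x ∂ρ f, Real.exp (-x) ∈ Icc (0 : ℝ) 1 := by
    intro f
    refine (withDensity_absolutelyContinuous _ _).ae_le ?_
    filter_upwards [ae_restrict_mem measurableSet_Ioi] with x hx
    exact ⟨(Real.exp_pos _).le, Real.exp_le_one_iff.2 (by simpa using (mem_Ioi.1 hx).le)⟩
  have hmom : ∀ {f : ℝ → ℝ}, (∀ x, 0 ≤ f x) → Measurable f → ∀ n : ℕ,
      (ρ f)[(fun x : ℝ => Real.exp (-x)) ^ n] = (∫⁻ x in Ioi (0 : ℝ),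
        ENNReal.ofReal (Real.exp (-((L + 1 + n) * x)) * f x)).toReal := by
    intro f hf hfm n
    simp only [Pi.pow_apply]
    rw [integral_eq_lintegral_of_nonneg_ae (ae_of_all _ fun x => pow_nonneg (Real.exp_pos _).le n)
      (by fun_prop)]
    rw [lintegral_withDensity_eq_lintegral_mul _ (hdm hfm) (by fun_prop)]
    congr 1
    refine lintegral_congr fun x => ?_
    simp only [hd, Pi.mul_apply]
    rw [← ENNReal.ofReal_mul (mul_nonneg (Real.exp_pos _).le (hf x))]
    congr 1
    rw [← Real.exp_nat_mul, mul_right_comm, ← Real.exp_add]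
    congr 2
    ring
  have hmap : (ρ f).map (fun x : ℝ => Real.exp (-x)) = (ρ g).map (fun x : ℝ => Real.exp (-x)) := by
    refine map_eq_of_moments hTm (hT01 f) (hT01 g) fun n => ?_
    rw [hmom hf hfm, hmom hg hgm, h]
    have : (0 : ℝ) ≤ n := n.cast_nonneg
    linarith
  have hemb : MeasurableEmbedding fun x : ℝ => Real.exp (-x) :=
    hTm.measurableEmbedding fun x y hxy => by simpa using hxy
  have hρeq : ρ f = ρ g := by
    rw [← hemb.comap_map (ρ f), hmap, hemb.comap_map]
  have hae : d f =ᵐ[volume.restrict (Ioi (0 : ℝ))] d g :=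
    (withDensity_eq_iff (hdm hfm).aemeasurable (hdm hgm).aemeasurable (hfin _ hL)).1 hρeq
  have hae' : f =ᵐ[volume.restrict (Ioi (0 : ℝ))] g := by
    filter_upwards [hae] with x hx
    have hx' := (ENNReal.ofReal_eq_ofReal_iff (mul_nonneg (Real.exp_pos _).le (hf x))
      (mul_nonneg (Real.exp_pos _).le (hg x))).1 hx
    exact mul_left_cancel₀ (Real.exp_pos _).ne' hx'
  have h1 : EqOn f g (Ioi 0) := Measure.eqOn_open_of_ae_eq hae' isOpen_Ioi
    (hfc.mono Ioi_subset_Ici_self) (hgc.mono Ioi_subset_Ici_self)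
  exact h1.of_subset_closure hfc hgc Ioi_subset_Ici_self (by rw [closure_Ioi])

theorem measurable_of_continuousOn_Ici {f : ℝ → ℝ} (h0 : ∀ x, x < 0 → f x = 0)
    (hc : ContinuousOn f (Ici 0)) : Measurable f := by
  have : f = (Ici (0 : ℝ)).piecewise f 0 := by
    ext x
    by_cases hx : x ∈ Ici (0 : ℝ)
    · simp [hx]
    · simp only [hx, not_false_eq_true, piecewise_eq_of_notMem, Pi.zero_apply]
      exact h0 x (not_le.1 hx)
  rw [this]
  exact hc.measurable_piecewise continuousOn_const measurableSet_Ici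

theorem IsScaleFunction.measurable {ψ : ℝ → ℝ} {q : ℝ} {W : ℝ → ℝ} (h : IsScaleFunction ψ q W) :
    Measurable W :=
  measurable_of_continuousOn_Ici h.zero_of_neg h.continuousOn

theorem IsScaleFunction.unique {ψ : ℝ → ℝ} {q : ℝ} {V W : ℝ → ℝ} (hV : IsScaleFunction ψ q V)
    (hW : IsScaleFunction ψ q W) : V = W := by
  ext x
  rcases lt_or_ge x 0 with hx | hx
  · rw [hV.zero_of_neg x hx, hW.zero_of_neg x hx]
  · refine eqOn_of_lintegral_exp_eq hV.nonneg hW.nonneg hV.measurable hW.measurable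
      hV.continuousOn hW.continuousOn (L := rightInverse ψ q) (fun l hl => ?_) (fun l hl => ?_) hx
    · rw [hV.laplace l hl]; exact ENNReal.ofReal_ne_top
    · rw [hV.laplace l hl, hW.laplace l hl]

theorem IsScaleFunction.scaleW_eq {ψ : ℝ → ℝ} {q : ℝ} {W : ℝ → ℝ} (h : IsScaleFunction ψ q W) :
    scaleW ψ q = W := by
  have hex : ∃ W, IsScaleFunction ψ q W := ⟨W, h⟩
  rw [scaleW, dif_pos hex]
  exact hex.choose_spec.unique h

theorem scaleW_eq_zero_of_not_exists {ψ : ℝ → ℝ} {q : ℝ} (h : ¬ ∃ W, IsScaleFunction ψ q W) :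
    scaleW ψ q = 0 := dif_neg h

theorem scaleW_zero_of_neg (ψ : ℝ → ℝ) (q : ℝ) {x : ℝ} (hx : x < 0) : scaleW ψ q x = 0 := by
  by_cases h : ∃ W, IsScaleFunction ψ q W
  · obtain ⟨W, hW⟩ := h
    rw [hW.scaleW_eq, hW.zero_of_neg x hx]
  · rw [scaleW_eq_zero_of_not_exists h, Pi.zero_apply]

theorem continuousOn_scaleW (ψ : ℝ → ℝ) (q : ℝ) : ContinuousOn (scaleW ψ q) (Ici 0) := by
  by_cases h : ∃ W, IsScaleFunction ψ q W
  · obtain ⟨W, hW⟩ := h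
    rw [hW.scaleW_eq]
    exact hW.continuousOn
  · rw [scaleW_eq_zero_of_not_exists h]
    exact continuousOn_const

theorem measurable_scaleW (ψ : ℝ → ℝ) (q : ℝ) : Measurable (scaleW ψ q) :=
  measurable_of_continuousOn_Ici (fun _ => scaleW_zero_of_neg ψ q) (continuousOn_scaleW ψ q)

/-- If `ψ` is eventually constant, it has no scale function other than `0`. -/
theorem scaleW_eq_zero_of_eventually_const {ψ : ℝ → ℝ} {q c : ℝ} (h : ∀ᶠ l in atTop, ψ l = c) :
    scaleW ψ q = 0 := by
  by_cases hex : ∃ W, IsScaleFunction ψ q W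
  swap
  · exact scaleW_eq_zero_of_not_exists hex
  obtain ⟨W, hW⟩ := hex
  rw [hW.scaleW_eq]
  obtain ⟨L, hL⟩ := eventually_atTop.1 (h.and (eventually_gt_atTop (rightInverse ψ q)))
  set e : ℝ → ℝ → ℝ≥0∞ := fun l x => ENNReal.ofReal (Real.exp (-(l * x)) * W x) with he
  have hm : ∀ l, Measurable (e l) := fun l => by
    have := hW.measurable
    simp only [he]; fun_prop
  have heq : ∀ l, L ≤ l → ∫⁻ x in Ioi (0 : ℝ), e l x = ENNReal.ofReal (1 / (c - q)) :=
    fun l hl => by rw [← (hL l hl).1]; exact hW.laplace l (hL l hl).2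
  have hle : ∀ᵐ x ∂volume.restrict (Ioi (0 : ℝ)), e (L + 1) x ≤ e L x := by
    filter_upwards [ae_restrict_mem measurableSet_Ioi] with x hx
    refine ENNReal.ofReal_le_ofReal (mul_le_mul_of_nonneg_right (Real.exp_le_exp.2 ?_) (hW.nonneg x))
    have : 0 < x := hx
    linarith
  have hfin : ∫⁻ x in Ioi (0 : ℝ), e (L + 1) x ≠ ∞ := by
    rw [heq _ (by linarith)]; exact ENNReal.ofReal_ne_top
  have hae : e (L + 1) =ᵐ[volume.restrict (Ioi (0 : ℝ))] e L :=
    ae_eq_of_ae_le_of_lintegral_le hle hfin (hm L).aemeasurable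
      (by rw [heq L le_rfl, heq (L + 1) (by linarith)])
  have hW0 : W =ᵐ[volume.restrict (Ioi (0 : ℝ))] 0 := by
    filter_upwards [hae, ae_restrict_mem measurableSet_Ioi] with x hx hx0
    have hx' := (ENNReal.ofReal_eq_ofReal_iff (mul_nonneg (Real.exp_pos _).le (hW.nonneg x))
      (mul_nonneg (Real.exp_pos _).le (hW.nonneg x))).1 hx
    rcases mul_eq_mul_right_iff.1 hx' with h1 | h1
    · have : 0 < x := hx0
      have := Real.exp_injective h1
      linarith
    · exact h1
  have h1 : EqOn W 0 (Ioi 0) := Measure.eqOn_open_of_ae_eq hW0 isOpen_Ioi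
    (hW.continuousOn.mono Ioi_subset_Ici_self) continuousOn_const
  have h2 : EqOn W 0 (Ici 0) := h1.of_subset_closure hW.continuousOn continuousOn_const
    Ioi_subset_Ici_self (by rw [closure_Ioi])
  ext x
  rcases lt_or_ge x 0 with hx | hx
  · exact hW.zero_of_neg x hx
  · exact h2 hx

section Esscher

variable {Ω : Type*} {mΩ : MeasurableSpace Ω} {ℱ : Filtration ℝ≥0 mΩ} {X : ℝ≥0 → Ω → ℝ}
  {P Pθ : Measure Ω} {θ : ℝ}

theorem IsEsscherTransform.isProbabilityMeasure [IsProbabilityMeasure P]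
    (h : IsEsscherTransform ℱ X P θ Pθ) : IsProbabilityMeasure Pθ := by
  refine ⟨?_⟩
  rw [h 0 univ MeasurableSet.univ]
  simp

/-- The Esscher transform exists only at exponents with a finite exponential moment. -/
theorem IsEsscherTransform.integrable_exp_mul [IsProbabilityMeasure P]
    (hX : ∀ t : ℝ≥0, Measurable[ℱ t] (X t)) (h0 : ∀ᵐ ω ∂P, X 0 ω = 0)
    (h : IsEsscherTransform ℱ X P θ Pθ) : Integrable (fun ω => Real.exp (θ * X 1 ω)) P := by
  have := h.isProbabilityMeasure
  have hXm : ∀ t, Measurable (X t) := fun t => (hX t).mono (ℱ.le t) le_rfl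
  have hm : Measurable fun ω => Real.exp (θ * (X 1 ω - X 0 ω) -
      laplaceExponent X P θ * ((1 : ℝ≥0) : ℝ)) := by
    have := hXm 1; have := hXm 0; fun_prop
  have hint : Integrable (fun ω => Real.exp (θ * (X 1 ω - X 0 ω) -
      laplaceExponent X P θ * ((1 : ℝ≥0) : ℝ))) P := by
    refine (lintegral_ofReal_ne_top_iff_integrable hm.aestronglyMeasurable
      (ae_of_all _ fun ω => (Real.exp_pos _).le)).1 ?_
    have := h 1 univ MeasurableSet.univ
    rw [Measure.restrict_univ] at this
    rw [← this]
    exact measure_ne_top _ _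
  refine (hint.mul_const (Real.exp (laplaceExponent X P θ))).congr ?_
  filter_upwards [h0] with ω hω
  rw [← Real.exp_add, hω]
  simp

/-- The moment generating function of `X 1` is shifted by the Esscher transform. -/
theorem IsEsscherTransform.mgf_eq (hX : ∀ t : ℝ≥0, Measurable[ℱ t] (X t))
    (h0 : ∀ᵐ ω ∂P, X 0 ω = 0) (h : IsEsscherTransform ℱ X P θ Pθ) (l : ℝ) :
    mgf (X 1) Pθ l = Real.exp (-laplaceExponent X P θ) * mgf (X 1) P (l + θ) := by
  have hXm : Measurable (X 1) := (hX 1).mono (ℱ.le 1) le_rfl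
  set D : Ω → ℝ := fun ω => Real.exp (θ * X 1 ω - laplaceExponent X P θ) with hD
  have hDm : Measurable D := by fun_prop
  have hmap : Pθ.map (X 1) = (P.withDensity fun ω => ENNReal.ofReal (D ω)).map (X 1) := by
    ext s hs
    rw [Measure.map_apply hXm hs, Measure.map_apply hXm hs, h 1 _ (hX 1 hs),
      withDensity_apply _ (hXm hs)]
    refine lintegral_congr_ae (ae_restrict_of_ae ?_)
    filter_upwards [h0] with ω hω
    simp [hD, hω]
  rw [← mgf_id_map hXm.aemeasurable, hmap, mgf_id_map hXm.aemeasurable]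
  simp only [mgf]
  rw [integral_withDensity_eq_integral_toReal_smul (by fun_prop)
    (ae_of_all _ fun ω => ENNReal.ofReal_lt_top), ← integral_const_mul]
  refine integral_congr_ae (ae_of_all _ fun ω => ?_)
  simp only [hD]
  rw [ENNReal.toReal_ofReal (Real.exp_pos _).le, smul_eq_mul, ← Real.exp_add, ← Real.exp_add]
  congr 1
  ring

theorem IsEsscherTransform.laplaceExponent_eq [IsProbabilityMeasure P]
    (hX : ∀ t : ℝ≥0, Measurable[ℱ t] (X t)) (h0 : ∀ᵐ ω ∂P, X 0 ω = 0)
    (h : IsEsscherTransform ℱ X P θ Pθ) {l : ℝ}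
    (hl : Integrable (fun ω => Real.exp ((l + θ) * X 1 ω)) P) :
    laplaceExponent X Pθ l = laplaceExponent X P (l + θ) - laplaceExponent X P θ := by
  rw [laplaceExponent, cgf, h.mgf_eq hX h0, Real.log_mul (Real.exp_pos _).ne' (mgf_pos hl).ne',
    Real.log_exp]
  simp only [laplaceExponent, cgf]
  ring

theorem laplaceExponent_of_not_integrable {l : ℝ}
    (hl : ¬ Integrable (fun ω => Real.exp (l * X 1 ω)) P) : laplaceExponent X P l = 0 := by
  rw [laplaceExponent, cgf, mgf_undef hl, Real.log_zero]

end Esscher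

theorem rightInverse_nonneg (ψ : ℝ → ℝ) (q : ℝ) : 0 ≤ rightInverse ψ q :=
  Real.sSup_nonneg fun _ hl => hl.1

/-- Shifting the Laplace exponent shifts its right inverse. -/
theorem rightInverse_shift {ψ φ : ℝ → ℝ} {p θ : ℝ} (hθ : θ ∈ Icc 0 (rightInverse ψ p))
    (hφ : ∀ l, 0 ≤ l → φ l = ψ (l + θ) - ψ θ) :
    rightInverse φ (p - ψ θ) = rightInverse ψ p - θ := by
  obtain ⟨h0, h1⟩ := hθ
  rcases h0.eq_or_lt with rfl | h0
  · rw [sub_zero]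
    simp only [rightInverse]
    congr 1
    ext l
    refine and_congr_right fun hl => ?_
    rw [hφ l hl, add_zero, sub_left_inj]
  have hbdd : BddAbove {l : ℝ | 0 ≤ l ∧ ψ l = p} := by
    by_contra hb
    rw [rightInverse, Real.sSup_of_not_bddAbove hb] at h1
    linarith
  have hmem : ∀ m, 0 ≤ m → φ m = p - ψ θ → m + θ ≤ rightInverse ψ p := fun m hm h =>
    le_csSup hbdd ⟨by linarith, by rw [hφ m hm] at h; linarith⟩
  refine le_antisymm ?_ ?_
  · exact Real.sSup_le (fun m hm => by linarith [hmem m hm.1 hm.2]) (by linarith)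
  · rw [sub_le_iff_le_add]
    refine Real.sSup_le (fun m hm => ?_) (by linarith [rightInverse_nonneg φ (p - ψ θ)])
    rcases le_total m θ with h | h
    · linarith [rightInverse_nonneg φ (p - ψ θ)]
    · rw [← sub_le_iff_le_add]
      refine le_csSup ⟨rightInverse ψ p - θ, fun k hk => ?_⟩ ⟨by linarith, ?_⟩
      · linarith [hmem k hk.1 hk.2]
      · rw [hφ _ (by linarith), sub_add_cancel, hm.2]

/-- Exponential tilting of scale functions. -/
theorem IsScaleFunction.tilt {ψ φ : ℝ → ℝ} {q r θ : ℝ} {W V : ℝ → ℝ}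
    (hΦ : rightInverse φ r = rightInverse ψ q - θ)
    (hφ : ∀ l, rightInverse φ r < l → φ l - r = ψ (l + θ) - q)
    (hV : ∀ x, V x = Real.exp (-(θ * x)) * W x) (hW : IsScaleFunction ψ q W) :
    IsScaleFunction φ r V where
  nonneg x := hV x ▸ mul_nonneg (Real.exp_pos _).le (hW.nonneg x)
  zero_of_neg x hx := by rw [hV, hW.zero_of_neg x hx, mul_zero]
  continuousOn := by
    refine ContinuousOn.congr ?_ fun x _ => hV x
    exact ContinuousOn.mul (by fun_prop) hW.continuousOn
  laplace l hl := by
    rw [hφ l hl, ← hW.laplace (l + θ) (by linarith)]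
    refine lintegral_congr fun x => ?_
    rw [hV, ← mul_assoc, ← Real.exp_add]
    congr 3
    ring

theorem scaleW_shift {ψ φ : ℝ → ℝ} {p θ : ℝ} (hθ : θ ∈ Icc 0 (rightInverse ψ p))
    (hφ : ∀ l, 0 ≤ l → φ l = ψ (l + θ) - ψ θ) (x : ℝ) :
    scaleW ψ p x = Real.exp (θ * x) * scaleW φ (p - ψ θ) x := by
  have hΦ := rightInverse_shift hθ hφ
  by_cases hex : ∃ W, IsScaleFunction ψ p W
  · obtain ⟨W, hW⟩ := hex
    have hV : IsScaleFunction φ (p - ψ θ) (fun x => Real.exp (-(θ * x)) * W x) := by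
      refine hW.tilt hΦ (fun l hl => ?_) fun x => rfl
      rw [hφ l ((rightInverse_nonneg _ _).trans hl.le)]
      ring
    rw [hW.scaleW_eq, hV.scaleW_eq, ← mul_assoc, ← Real.exp_add, add_neg_cancel, Real.exp_zero,
      one_mul]
  · have hex' : ¬ ∃ V, IsScaleFunction φ (p - ψ θ) V := by
      rintro ⟨V, hV⟩
      refine hex ⟨fun x => Real.exp (-(-θ * x)) * V x, hV.tilt (θ := -θ) ?_ (fun l hl => ?_) fun x => rfl⟩
      · rw [hΦ]; ring
      · rw [hφ _ (by linarith [hθ.2]), neg_add_cancel_right]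
        ring
    rw [scaleW_eq_zero_of_not_exists hex, scaleW_eq_zero_of_not_exists hex']
    simp

/-- The scale functions of a process and of its Esscher transform. -/
theorem IsEsscherTransform.scaleW_eq {Ω : Type*} {mΩ : MeasurableSpace Ω} {ℱ : Filtration ℝ≥0 mΩ}
    {X : ℝ≥0 → Ω → ℝ} {P Pθ : Measure Ω} {p θ : ℝ} [IsProbabilityMeasure P]
    (hX : ∀ t : ℝ≥0, Measurable[ℱ t] (X t)) (h0 : ∀ᵐ ω ∂P, X 0 ω = 0)
    (hθ : θ ∈ Icc 0 (rightInverse (laplaceExponent X P) p))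
    (h : IsEsscherTransform ℱ X P θ Pθ) (x : ℝ) :
    scaleW (laplaceExponent X P) p x = Real.exp (θ * x) *
      scaleW (laplaceExponent X Pθ) (p - laplaceExponent X P θ) x := by
  by_cases hint : ∀ l, 0 ≤ l → Integrable (fun ω => Real.exp ((l + θ) * X 1 ω)) P
  · exact scaleW_shift hθ (fun l hl => h.laplaceExponent_eq hX h0 (hint l hl)) x
  push Not at hint
  obtain ⟨a, ha, hna⟩ := hint
  have hni : ∀ l, a + θ ≤ l → ¬ Integrable (fun ω => Real.exp (l * X 1 ω)) P := fun l hl hi =>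
    hna (integrable_exp_mul_of_nonneg_of_le hi (by linarith [hθ.1]) hl)
  have hψ : ∀ᶠ l in atTop, laplaceExponent X P l = 0 := by
    filter_upwards [eventually_ge_atTop (a + θ)] with l hl
    exact laplaceExponent_of_not_integrable (hni l hl)
  have hφ : ∀ᶠ l in atTop, laplaceExponent X Pθ l = 0 := by
    filter_upwards [eventually_ge_atTop a] with l hl
    rw [laplaceExponent, cgf, h.mgf_eq hX h0, mgf_undef (hni (l + θ) (by linarith)), mul_zero,
      Real.log_zero]
  rw [scaleW_eq_zero_of_eventually_const hψ, scaleW_eq_zero_of_eventually_const hφ]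
  simp

/-- Multiplication by an exponential commutes with convolution. -/
theorem convolution_exp_mul (θ : ℝ) (f g : ℝ → ℝ) (x : ℝ) :
    ((fun u => Real.exp (θ * u) * f u) ⋆ fun u => Real.exp (θ * u) * g u) x
      = Real.exp (θ * x) * (f ⋆ g) x := by
  rw [convolution_lsmul, convolution_lsmul, ← integral_const_mul]
  congr 1
  ext t
  have : Real.exp (θ * x) = Real.exp (θ * t) * Real.exp (θ * (x - t)) := by
    rw [← Real.exp_add]; congr 1; ring
  simp only [smul_eq_mul, this]
  ring

theorem scaleZ_shift {ψ φ : ℝ → ℝ} {p θ : ℝ} (hφ : φ 0 = 0)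
    (hW : ∀ x, scaleW ψ p x = Real.exp (θ * x) * scaleW φ (p - ψ θ) x) (x : ℝ) :
    scaleZ ψ p θ x = Real.exp (θ * x) * scaleZ φ (p - ψ θ) 0 x := by
  have hi : ((Ici (0 : ℝ)).indicator fun u => Real.exp (θ * u)) =
      fun u => Real.exp (θ * u) * (Ici (0 : ℝ)).indicator (fun u => Real.exp (0 * u)) u := by
    ext u
    by_cases hu : u ∈ Ici (0 : ℝ) <;> simp [hu]
  rw [scaleZ, scaleZ, funext hW, hi, convolution_exp_mul, hφ]
  simp only [zero_mul, Real.exp_zero]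
  ring

theorem IsZSolution.tilt {ψ φ : ℝ → ℝ} {α p r q θ η κ : ℝ} {f g : ℝ → ℝ}
    (hW : ∀ x, scaleW φ r x = Real.exp (κ * x) * scaleW ψ p x)
    (hZ : ∀ x, scaleZ φ r η x = Real.exp (κ * x) * scaleZ ψ p θ x)
    (hg : ∀ x, g x = Real.exp (κ * x) * f x) (hf : IsZSolution ψ α p q θ f) :
    IsZSolution φ α r q η g where
  measurable := by
    have := hf.measurable
    rw [funext hg]; fun_prop
  locally_bounded s := by
    obtain ⟨C, hC⟩ := hf.locally_bounded s
    refine ⟨Real.exp (|κ| * s) * C, fun x hx => ?_⟩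
    rw [hg, abs_mul, abs_of_pos (Real.exp_pos _)]
    have h1 : κ * x ≤ |κ| * s := (le_abs_self _).trans
      (by rw [abs_mul]; exact mul_le_mul_of_nonneg_left hx (abs_nonneg _))
    exact mul_le_mul (Real.exp_le_exp.2 h1) (hC x hx) (abs_nonneg _) (Real.exp_pos _).le
  equation x := by
    have hi : ((Ici (0 : ℝ)).indicator fun u => Real.exp (α * u) * g u) =
        fun u => Real.exp (κ * u) *
          (Ici (0 : ℝ)).indicator (fun u => Real.exp (α * u) * f u) u := by
      ext u
      by_cases hu : u ∈ Ici (0 : ℝ)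
      · simp only [hu, indicator_of_mem, hg]; ring
      · simp [hu]
    rw [hi, funext hW, convolution_exp_mul, hZ, hg, hf.equation x]
    ring

/-- A bounded function on `[0,R]` that is dominated by a multiple of its integral vanishes. -/
theorem eq_zero_of_abs_le_integral {g : ℝ → ℝ} {M C R : ℝ} (hC : 0 ≤ C)
    (hM : ∀ x ∈ Icc 0 R, |g x| ≤ M) (hgm : Measurable g)
    (hg : ∀ x ∈ Icc 0 R, |g x| ≤ C * ∫ u in (0 : ℝ)..x, |g u|) :
    ∀ x ∈ Icc 0 R, g x = 0 := by
  have hint : ∀ x ∈ Icc 0 R, IntervalIntegrable (fun u => |g u|) volume 0 x := by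
    intro x hx
    rw [intervalIntegrable_iff_integrableOn_Ioc_of_le hx.1]
    refine Measure.integrableOn_of_bounded (M := M) (by simp) (by fun_prop) ?_
    filter_upwards [ae_restrict_mem measurableSet_Ioc] with u hu
    rw [Real.norm_eq_abs, abs_abs]
    exact hM u ⟨hu.1.le, hu.2.trans hx.2⟩
  have key : ∀ n : ℕ, ∀ x ∈ Icc 0 R, |g x| ≤ M * ((C * x) ^ n / n.factorial) := by
    intro n
    induction n with
    | zero => intro x hx; simpa using hM x hx
    | succ n ih =>
      intro x hx
      have h1 : ∫ u in (0 : ℝ)..x, |g u| ≤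
          ∫ u in (0 : ℝ)..x, M * C ^ n / n.factorial * u ^ n := by
        refine intervalIntegral.integral_mono_on hx.1 (hint x hx)
          (Continuous.intervalIntegrable (by fun_prop) _ _) fun u hu => ?_
        refine (ih u ⟨hu.1, hu.2.trans hx.2⟩).trans (le_of_eq ?_)
        rw [mul_pow]; ring
      refine ((hg x hx).trans (mul_le_mul_of_nonneg_left h1 hC)).trans (le_of_eq ?_)
      rw [intervalIntegral.integral_const_mul, integral_pow, Nat.factorial_succ]
      push_cast
      have : (n.factorial : ℝ) ≠ 0 := by positivity
      have : (n : ℝ) + 1 ≠ 0 := by positivity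
      field_simp
      ring
  intro x hx
  have hlim : Tendsto (fun n : ℕ => M * ((C * x) ^ n / n.factorial)) atTop (𝓝 (M * 0)) :=
    (FloorSemiring.tendsto_pow_div_factorial_atTop (C * x)).const_mul M
  rw [mul_zero] at hlim
  exact abs_nonpos_iff.1 (ge_of_tendsto' hlim fun n => key n x hx)

/-- The convolution of two functions supported on `[0,∞)`. -/
theorem convolution_eq_integral_Icc {f h : ℝ → ℝ} (hf : ∀ x, x < 0 → f x = 0) (x : ℝ) :
    (f ⋆ (Ici (0 : ℝ)).indicator h) x = ∫ u in Icc 0 x, f (x - u) * h u := by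
  rw [convolution_lsmul_swap, ← integral_indicator measurableSet_Icc]
  congr 1
  ext u
  by_cases h0 : 0 ≤ u
  · by_cases h1 : u ≤ x
    · simp [h0, h1]
    · simp [h1, hf (x - u) (by linarith [not_le.1 h1])]
  · simp [h0]

theorem IsZSolution.unique {ψ : ℝ → ℝ} {α p q θ : ℝ} {f₁ f₂ : ℝ → ℝ}
    (h₁ : IsZSolution ψ α p q θ f₁) (h₂ : IsZSolution ψ α p q θ f₂) : f₁ = f₂ := by
  set W := scaleW ψ p with hW
  have hWm : Measurable W := measurable_scaleW ψ p
  have hm₁ := h₁.measurable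
  have hm₂ := h₂.measurable
  have hconv : ∀ (f : ℝ → ℝ), IsZSolution ψ α p q θ f → ∀ x, f x = scaleZ ψ p θ x
      + q * ∫ u in Icc 0 x, W (x - u) * (Real.exp (α * u) * f u) := fun f hf x => by
    rw [hf.equation x, convolution_eq_integral_Icc fun _ => scaleW_zero_of_neg ψ p]
  have hzero : ∀ R, 0 ≤ R → ∀ x ∈ Icc 0 R, f₁ x - f₂ x = 0 := by
    intro R hR
    obtain ⟨M₁, hM₁⟩ := h₁.locally_bounded R
    obtain ⟨M₂, hM₂⟩ := h₂.locally_bounded R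
    have hK := isCompact_Icc.exists_bound_of_continuousOn (s := Icc 0 R)
      ((continuousOn_scaleW ψ p).mono Icc_subset_Ici_self)
    obtain ⟨B, hB⟩ := hK
    have hE := isCompact_Icc.exists_bound_of_continuousOn (s := Icc 0 R)
      (f := fun u => Real.exp (α * u)) (by fun_prop)
    obtain ⟨E, hE⟩ := hE
    have hB0 : 0 ≤ B := (norm_nonneg _).trans (hB 0 ⟨le_rfl, hR⟩)
    have hE0 : 0 ≤ E := (norm_nonneg _).trans (hE 0 ⟨le_rfl, hR⟩)
    have habs : ∀ {u : ℝ}, u ∈ Icc 0 R → |u| ≤ R := fun hu => by rw [abs_of_nonneg hu.1]; exact hu.2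
    have hker : ∀ x ∈ Icc 0 R, ∀ u ∈ Icc 0 x, |W (x - u) * Real.exp (α * u)| ≤ B * E := by
      intro x hx u hu
      rw [abs_mul]
      exact mul_le_mul (hB _ ⟨by linarith [hu.2], by linarith [hu.1, hx.2]⟩)
        (hE u ⟨hu.1, hu.2.trans hx.2⟩) (abs_nonneg _) hB0
    have hi : ∀ x ∈ Icc 0 R, ∀ (f : ℝ → ℝ) (M : ℝ), Measurable f → (∀ u, |u| ≤ R → |f u| ≤ M) →
        IntegrableOn (fun u => W (x - u) * (Real.exp (α * u) * f u)) (Icc 0 x) := by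
      intro x hx f M hf hM
      refine Measure.integrableOn_of_bounded (M := B * E * M) (by simp) (by fun_prop) ?_
      filter_upwards [ae_restrict_mem measurableSet_Icc] with u hu
      rw [← mul_assoc, norm_mul]
      exact mul_le_mul (hker x hx u hu) (hM u (habs ⟨hu.1, hu.2.trans hx.2⟩)) (abs_nonneg _)
        (mul_nonneg hB0 hE0)
    refine eq_zero_of_abs_le_integral (C := |q| * (B * E)) (M := M₁ + M₂) (by positivity)
      (fun x hx => ?_) (hm₁.sub hm₂) fun x hx => ?_
    · exact (abs_sub _ _).trans (add_le_add (hM₁ x (habs hx)) (hM₂ x (habs hx)))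
    · have hd : f₁ x - f₂ x
          = q * ∫ u in Icc 0 x, W (x - u) * Real.exp (α * u) * (f₁ u - f₂ u) := by
        rw [hconv f₁ h₁ x, hconv f₂ h₂ x, add_sub_add_left_eq_sub, ← mul_sub,
          ← integral_sub (hi x hx f₁ M₁ hm₁ hM₁) (hi x hx f₂ M₂ hm₂ hM₂)]
        congr 2
        ext u
        ring
      rw [hd, abs_mul, mul_assoc, intervalIntegral.integral_of_le hx.1,
        ← integral_Icc_eq_integral_Ioc, ← integral_const_mul]
      refine mul_le_mul_of_nonneg_left ?_ (abs_nonneg q)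
      rw [← Real.norm_eq_abs]
      refine norm_integral_le_of_norm_le ?_ ?_
      · refine Integrable.const_mul ?_ _
        refine Measure.integrableOn_of_bounded (M := M₁ + M₂) (by simp) (by fun_prop) ?_
        filter_upwards [ae_restrict_mem measurableSet_Icc] with u hu
        have hu' := habs (u := u) ⟨hu.1, hu.2.trans hx.2⟩
        rw [Real.norm_eq_abs, abs_abs]
        exact (abs_sub _ _).trans (add_le_add (hM₁ u hu') (hM₂ u hu'))
      · filter_upwards [ae_restrict_mem measurableSet_Icc] with u hu
        rw [norm_mul]
        exact mul_le_mul_of_nonneg_right (hker x hx u hu) (abs_nonneg _)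
  ext x
  rcases lt_or_ge x 0 with hx | hx
  · rw [hconv f₁ h₁ x, hconv f₂ h₂ x, Icc_eq_empty hx.not_ge]
    simp
  · exact sub_eq_zero.1 (hzero x hx x ⟨hx, le_rfl⟩)

theorem IsZSolution.pssmpZ_eq {ψ : ℝ → ℝ} {α p q θ : ℝ} {f : ℝ → ℝ}
    (h : IsZSolution ψ α p q θ f) (y : ℝ) : pssmpZ ψ α p q θ y = f (Real.log y) := by
  have hex : ∃ f, IsZSolution ψ α p q θ f := ⟨f, h⟩
  rw [pssmpZ, dif_pos hex, hex.choose_spec.unique h]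

theorem pssmpZ_eq_zero_of_not_exists {ψ : ℝ → ℝ} {α p q θ : ℝ}
    (h : ¬ ∃ f, IsZSolution ψ α p q θ f) (y : ℝ) : pssmpZ ψ α p q θ y = 0 := by
  rw [pssmpZ, dif_neg h, Pi.zero_apply]

theorem proposition3p8 {Ω : Type*} {mΩ : MeasurableSpace Ω}
    (ℱ : Filtration ℝ≥0 mΩ) (X : ℝ≥0 → Ω → ℝ) (P : Measure Ω) [IsProbabilityMeasure P]
    (hX : IsSpectrallyNegativeLevy ℱ X P)
    (α p q θ : ℝ) (hp : 0 ≤ p) (hq : 0 ≤ q)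
    (hθ : θ ∈ Icc 0 (rightInverse (laplaceExponent X P) p))
    (Pθ : Measure Ω) (hPθ : IsEsscherTransform ℱ X P θ Pθ)
    (y : ℝ) (hy : 0 < y) :
    pssmpZ (laplaceExponent X P) α p q θ y
      = pssmpZ (laplaceExponent X Pθ) α (p - laplaceExponent X P θ) q 0 y * y ^ θ := by
  have := hPθ.isProbabilityMeasure
  have hφ0 : laplaceExponent X Pθ 0 = 0 := cgf_zero
  have hW := hPθ.scaleW_eq hX.adapted hX.start_zero hθ
  have hZ := scaleZ_shift hφ0 hW
  have hinv : ∀ {a b : ℝ → ℝ}, (∀ x, a x = Real.exp (θ * x) * b x) →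
      ∀ x, b x = Real.exp (-θ * x) * a x := fun hab x => by
    rw [hab, ← mul_assoc, ← Real.exp_add, neg_mul, neg_add_cancel, Real.exp_zero, one_mul]
  by_cases hex : ∃ f, IsZSolution (laplaceExponent X Pθ) α (p - laplaceExponent X P θ) q 0 f
  · obtain ⟨f, hf⟩ := hex
    rw [hf.pssmpZ_eq, (hf.tilt hW hZ fun _ => rfl).pssmpZ_eq, Real.rpow_def_of_pos hy,
      mul_comm (Real.log y), mul_comm]
  · have hex' : ¬ ∃ f, IsZSolution (laplaceExponent X P) α p q θ f := fun ⟨f, hf⟩ =>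
      hex ⟨_, hf.tilt (hinv hW) (hinv hZ) fun _ => rfl⟩
    rw [pssmpZ_eq_zero_of_not_exists hex, pssmpZ_eq_zero_of_not_exists hex', zero_mul]
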